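/- There exists an absolute constant $C>0$ such that the following holds. Let $n\ge 2$ be an integer, let $u_1,\dots,u_n$ be real numbers, not all equal to zero, and let $\pi$ be a uniformly distributed random permutation of $\{1,\dots,n\}$. Then $$\mathbb{P}\Bigl\{\Bigl|\sum_{i=1}^n u_i\,\pi(i)\Bigr|\le\Bigl|\sum_{i=1}^n u_i\Bigr|\Bigr\}\le\frac{C}{n}.$$ -/

import Mathlib

open MeasureTheory ProbabilityTheory

/-- Every set of permutations of a finite set is an event. -/
instance Equiv.Perm.instMeasurableSpaceFin (n : ℕ) : MeasurableSpace (Equiv.Perm (Fin n)) := ⊤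

/-- The uniform distribution on the symmetric group of degree `n`, each permutation having
probability `1 / n!`. -/
noncomputable def uniformPermutation (n : ℕ) : Measure (Equiv.Perm (Fin n)) :=
  (PMF.uniformOfFintype (Equiv.Perm (Fin n))).toMeasure

/-- The value of a permutation as a number in `{1, …, n}`; `Fin n` itself is `{0, …, n - 1}`. -/
def permValue {n : ℕ} (σ : Equiv.Perm (Fin n)) (i : Fin n) : ℝ := ((σ i : ℕ) : ℝ) + 1

/-!
Subtracting its mean `s (n + 1) / 2`, where `s = ∑ i, u i`, turns the permutation sum into
`T π = ∑ i, u i * (π i - (n + 1) / 2)` (`centeredSum`), and the event says that `T` lies in the window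
of radius `|s|` around the point `x = -s (n + 1) / 2`. The window is about `n / 4` times shorter than
its distance from the mean, so the bound `C / n` would be immediate if `T` were unimodal. The proof
replaces unimodality by two estimates, at two different scales. Let `M` be the largest distance of a
coefficient from the mean `s / n` of all of them.

* Coarse scale (`card_centeredSum_near_mul_le`). Reveal the pairs of mirror-image values `a`,
  `n + 1 - a` from the outside to the inside. The contributions of the pairs are the steps of a walk
  that ends at `T`; each step is at most `M n`, and reversing all values in an inner interval changes
  the sign of all later steps. The reflection principle, used at many levels between `0` and `x`,
  gives `P(|T - x| ≤ a) = O((a + M n) / |x|)`.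

* Fine scale (`card_near_le`). Let `u i₀` be the coefficient farthest from the mean, say above it. At
  least a third of all `j` have `u i₀ - u j ≥ M / 2`, because these differences have mean `M` and are at
  most `2 M`. Moving `i₀` through the values of these `j`, while their own relative order is kept, gives
  chains of at least `n / 3` permutations along which `T` grows by at least `M / 2` per step and by at
  most `2 M n` in total. Hence
  `P(|T - x| ≤ l) ≤ (3 / n) (1 + 4 l / M) P(|T - x| ≤ l + 2 M n)`.

If `|s| = O(M)`, the fine estimate suffices. If `|s| ≥ n M`, so does the coarse one with `a = |s|`; this
includes the case `M = 0` of equal coefficients. In between, the last probability of the fine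
estimate is `O(M n / |x|) = O(M / |s|)` by the coarse one, and the product is `O(1 / n)`.
-/

/-! ### The reflection principle -/

/-- Reflection principle for an abstract walk `W 0 = 0, W 1, …, W N` on a finite space: `φ k`
reverses all steps after time `k`. Reflecting at the first passage above `y` is injective and
carries the event that `W N` is near `x` into the event that `W N` is near `2 y - x`. -/
lemma card_le_card_of_reflection {Ω : Type*} [Fintype Ω] {W : ℕ → Ω → ℝ} {N : ℕ} {c : ℝ}
    {φ : ℕ → Ω → Ω} (hW0 : ∀ ω, W 0 ω = 0) (hstep : ∀ k ω, W (k + 1) ω - W k ω ≤ c)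
    (hφ : ∀ k, Function.Injective (φ k)) (hφW : ∀ j k ω, j ≤ k → W j (φ k ω) = W j ω)
    (hφN : ∀ k ω, W N (φ k ω) = 2 * W k ω - W N ω) {x a y : ℝ} (hy : 0 < y) (hyx : y ≤ x - a) :
    (Finset.univ.filter fun ω => |W N ω - x| ≤ a).card ≤
      (Finset.univ.filter fun ω => |W N ω - (2 * y - x + c)| ≤ a + c).card := by
  set τ : Ω → ℕ := fun ω => sInf {k | y ≤ W k ω} with hτ
  have hmem : ∀ ω, |W N ω - x| ≤ a → IsLeast {k | y ≤ W k ω} (τ ω) := fun ω hω =>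
    ⟨Nat.sInf_mem ⟨N, by have := (abs_le.1 hω).1; show y ≤ W N ω; linarith⟩,
      fun k hk => Nat.sInf_le hk⟩
  have hτφ : ∀ ω, |W N ω - x| ≤ a → τ (φ (τ ω) ω) = τ ω := by
    intro ω hω
    have hl : IsLeast {k | y ≤ W k (φ (τ ω) ω)} (τ ω) := by
      refine ⟨?_, fun k hk => ?_⟩
      · show y ≤ W (τ ω) (φ (τ ω) ω)
        rw [hφW _ _ _ le_rfl]
        exact (hmem ω hω).1
      · by_contra! hlt
        refine absurd ((hmem ω hω).2 (?_ : y ≤ W k ω)) (by omega)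
        rw [← hφW k (τ ω) ω hlt.le]
        exact hk
    exact hl.csInf_eq
  refine Finset.card_le_card_of_injOn (fun ω => φ (τ ω) ω) ?_ ?_
  · intro ω hω
    have hω : |W N ω - x| ≤ a := by simpa using hω
    have hle : y ≤ W (τ ω) ω := (hmem ω hω).1
    have hle' : W (τ ω) ω ≤ y + c := by
      rcases hk : τ ω with _ | k
      · rw [hk, hW0] at hle
        linarith
      · have h1 : W k ω < y := by
          by_contra! h
          have := (hmem ω hω).2 h
          omega
        linarith [hstep k ω]
    have := abs_le.1 hω
    simp only [Finset.coe_filter, Finset.mem_univ, true_and, Set.mem_ofPred_eq, hφN]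
    rw [abs_le]
    constructor <;> linarith
  · intro ω hω ω' hω' h
    have hω : |W N ω - x| ≤ a := by simpa using hω
    have hω' : |W N ω' - x| ≤ a := by simpa using hω'
    have h : φ (τ ω) ω = φ (τ ω') ω' := h
    have ht : τ ω = τ ω' := by rw [← hτφ ω hω, h, hτφ ω' hω']
    rw [ht] at h
    exact hφ _ h

/-- A walk to which the reflection principle applies ends in a window of radius `a` around `x` with
probability `O((a + c) / x)`: the levels `y` below `x - a` provide about `x / (a + c)` disjoint
windows, each at least as likely as the given one. -/
lemma card_mul_le_of_reflection {Ω : Type*} [Fintype Ω] [DecidableEq Ω] {W : ℕ → Ω → ℝ}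
    {N : ℕ} {c : ℝ} {φ : ℕ → Ω → Ω} (hW0 : ∀ ω, W 0 ω = 0) (hstep : ∀ k ω, W (k + 1) ω - W k ω ≤ c)
    (hφ : ∀ k, Function.Injective (φ k)) (hφW : ∀ j k ω, j ≤ k → W j (φ k ω) = W j ω)
    (hφN : ∀ k ω, W N (φ k ω) = 2 * W k ω - W N ω) {x a : ℝ} (hac : 0 < a + c) :
    ((Finset.univ.filter fun ω => |W N ω - x| ≤ a).card : ℝ) * ((x - a) / (2 * (a + c)) - 1) ≤
      Fintype.card Ω := by
  set b := 2 * (a + c) with hb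
  have hb0 : 0 < b := by linarith
  set A := Finset.univ.filter fun ω => |W N ω - x| ≤ a
  set J := ⌊(x - a) / b⌋₊ with hJ
  set B : ℕ → Finset Ω := fun j =>
    Finset.univ.filter fun ω => |W N ω - (2 * (b * (j + 1)) - x + c)| ≤ a + c with hB
  have hAB : ∀ j ∈ Finset.range J, A.card ≤ (B j).card := by
    intro j hj
    refine card_le_card_of_reflection hW0 hstep hφ hφW hφN (by positivity) ?_
    have h1 : (j : ℝ) + 1 ≤ J := by exact_mod_cast Finset.mem_range.1 hj
    have hJ0 : J ≠ 0 := by have := Finset.mem_range.1 hj; omega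
    have h2 : (J : ℝ) ≤ (x - a) / b := by
      apply Nat.floor_le
      by_contra! h
      exact hJ0 (Nat.floor_of_nonpos h.le)
    calc b * (j + 1) ≤ b * ((x - a) / b) := by gcongr; linarith
      _ = x - a := by field_simp
  have hdisj : (↑(Finset.range J) : Set ℕ).PairwiseDisjoint B := by
    have key : ∀ i j : ℕ, i < j → Disjoint (B i) (B j) := by
      intro i j hij
      rw [Finset.disjoint_left]
      intro ω hi hj
      have hi := (abs_le.1 (Finset.mem_filter.1 hi).2).2
      have hj := (abs_le.1 (Finset.mem_filter.1 hj).2).1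
      have hij' : (i : ℝ) + 1 ≤ j := by exact_mod_cast hij
      nlinarith [mul_le_mul_of_nonneg_left hij' hb0.le]
    intro i _ j _ hij
    rcases lt_or_gt_of_ne hij with h | h
    · exact key i j h
    · exact (key j i h).symm
  have hsum : J * A.card ≤ Fintype.card Ω := by
    calc J * A.card = ∑ _j ∈ Finset.range J, A.card := by simp
      _ ≤ ∑ j ∈ Finset.range J, (B j).card := Finset.sum_le_sum hAB
      _ = ((Finset.range J).biUnion B).card := (Finset.card_biUnion hdisj).symm
      _ ≤ Fintype.card Ω := Finset.card_le_univ _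
  have hfl : (x - a) / b - 1 ≤ J := by linarith [Nat.lt_floor_add_one ((x - a) / b)]
  calc (A.card : ℝ) * ((x - a) / b - 1) ≤ A.card * J := by gcongr
    _ ≤ Fintype.card Ω := by rw [mul_comm]; exact_mod_cast hsum

/-! ### The centred sum and partial reversals of the values -/

/-- The position of a value of a permutation relative to the centre `(n - 1) / 2` of `Fin n`. -/
noncomputable def centeredVal {n : ℕ} (a : Fin n) : ℝ := ((a : ℕ) : ℝ) - ((n : ℝ) - 1) / 2

/-- The permutation sum `∑ i, u i * π i` with its mean over all permutations subtracted. -/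
noncomputable def centeredSum {n : ℕ} (u : Fin n → ℝ) (π : Equiv.Perm (Fin n)) : ℝ :=
  ∑ i, u i * centeredVal (π i)

/-- The distance of `a` to the nearer end of `Fin n`; two values share it exactly when they are
equal or mirror images of each other. -/
def endDist {n : ℕ} (a : Fin n) : ℕ := min (a : ℕ) (a.rev : ℕ)

/-- Reversal of all values that have distance at least `k` from both ends. -/
def partialRev {n : ℕ} (k : ℕ) : Equiv.Perm (Fin n) :=
  Function.Involutive.toPerm (fun a => if k ≤ endDist a then a.rev else a) (by
    intro a
    by_cases h : k ≤ endDist a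
    · have h' : k ≤ endDist a.rev := by simpa [endDist, min_comm] using h
      simp [h, h']
    · simp [h])

/-- The part of the centred sum that comes from the values with distance less than `k` to the ends:
as `k` grows, a walk from `0` to `centeredSum u π`, in which `partialRev k` reverses all steps after
the `k`-th. -/
noncomputable def outerSum {n : ℕ} (u : Fin n → ℝ) (k : ℕ) (π : Equiv.Perm (Fin n)) : ℝ :=
  ∑ i, if endDist (π i) < k then u i * centeredVal (π i) else 0

lemma partialRev_apply {n : ℕ} (k : ℕ) (a : Fin n) :
    partialRev k a = if k ≤ endDist a then a.rev else a := rfl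

lemma endDist_rev {n : ℕ} (a : Fin n) : endDist a.rev = endDist a := by
  simp [endDist, min_comm]

lemma endDist_partialRev {n : ℕ} (k : ℕ) (a : Fin n) :
    endDist (partialRev k a) = endDist a := by
  rw [partialRev_apply]
  split_ifs
  · exact endDist_rev a
  · rfl

lemma centeredVal_rev {n : ℕ} (a : Fin n) : centeredVal a.rev = -centeredVal a := by
  have h : ((a.rev : ℕ) : ℝ) = n - (a + 1) := by
    rw [Fin.val_rev, Nat.cast_sub a.isLt]
    push_cast
    ring
  simp only [centeredVal, h]
  ring

lemma abs_centeredVal_le {n : ℕ} (a : Fin n) : |centeredVal a| ≤ n / 2 := by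
  have h : ((a : ℕ) : ℝ) + 1 ≤ n := by exact_mod_cast a.isLt
  have h0 : (0 : ℝ) ≤ ((a : ℕ) : ℝ) := by positivity
  rw [centeredVal, abs_le]
  constructor <;> linarith

lemma card_filter_endDist_le {n : ℕ} (k : ℕ) :
    (Finset.univ.filter fun a : Fin n => endDist a = k).card ≤ 2 := by
  have hinj : Set.InjOn (fun a : Fin n => (a : ℕ))
      (Finset.univ.filter fun a : Fin n => endDist a = k) := fun a _ b _ h => Fin.ext h
  rw [← Finset.card_image_of_injOn hinj]
  refine (Finset.card_le_card (t := {k, n - 1 - k}) ?_).trans Finset.card_le_two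
  intro m hm
  obtain ⟨a, ha, rfl⟩ := Finset.mem_image.1 hm
  have ha := (Finset.mem_filter.1 ha).2
  have := a.isLt
  simp only [endDist, Fin.val_rev] at ha
  simp only [Finset.mem_insert, Finset.mem_singleton]
  omega

lemma outerSum_succ_sub_le {n : ℕ} {u : Fin n → ℝ} {R : ℝ} (hR : ∀ i j, |u i - u j| ≤ R) (k : ℕ)
    (π : Equiv.Perm (Fin n)) : outerSum u (k + 1) π - outerSum u k π ≤ R * (n / 2) := by
  set F : Fin n → ℝ := fun a => if endDist a = k then u (π.symm a) * centeredVal a else 0 with hF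
  have h1 : outerSum u (k + 1) π - outerSum u k π = ∑ a, F a := by
    rw [outerSum, outerSum, ← Finset.sum_sub_distrib, ← Equiv.sum_comp π F]
    refine Finset.sum_congr rfl fun i _ => ?_
    simp only [hF, Equiv.symm_apply_apply]
    split_ifs <;> first | omega | simp
  -- The value `a` and its mirror image contribute with opposite signs, so only the difference of
  -- their coefficients counts.
  have h2 : ∑ a, F a + ∑ a, F a =
      ∑ a, if endDist a = k then (u (π.symm a) - u (π.symm a.rev)) * centeredVal a else 0 := by
    nth_rewrite 2 [← Equiv.sum_comp Fin.revPerm F]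
    rw [← Finset.sum_add_distrib]
    refine Finset.sum_congr rfl fun a _ => ?_
    simp only [hF, Fin.revPerm_apply, endDist_rev, centeredVal_rev]
    split_ifs <;> ring
  have h3 : ∑ a, F a + ∑ a, F a ≤ 2 * (R * (n / 2)) := by
    rw [h2, ← Finset.sum_filter]
    have hR0 : ∀ a : Fin n, 0 ≤ R := fun a => (abs_nonneg _).trans (hR a a)
    rcases isEmpty_or_nonempty (Fin n) with hn | ⟨⟨a0⟩⟩
    · have : n = 0 := (Fintype.card_fin n).symm.trans (Fintype.card_eq_zero_iff.2 hn)
      subst this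
      simp
    calc _ ≤ ∑ a ∈ Finset.univ.filter (fun a : Fin n => endDist a = k), R * ((n : ℝ) / 2) := by
          refine Finset.sum_le_sum fun a _ => (le_abs_self _).trans ?_
          rw [abs_mul]
          exact mul_le_mul (hR _ _) (abs_centeredVal_le a) (abs_nonneg _) (hR0 a0)
      _ = (Finset.univ.filter fun a : Fin n => endDist a = k).card * (R * ((n : ℝ) / 2)) := by
          rw [Finset.sum_const, nsmul_eq_mul]
      _ ≤ 2 * (R * (n / 2)) := by
          have := hR0 a0
          gcongr
          exact_mod_cast card_filter_endDist_le k
  linarith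

lemma outerSum_self {n : ℕ} (u : Fin n → ℝ) (π : Equiv.Perm (Fin n)) :
    outerSum u n π = centeredSum u π := by
  refine Finset.sum_congr rfl fun i _ => if_pos ?_
  exact (min_le_left _ _).trans_lt (π i).isLt

/-- The reflection estimate for the centred sum, for a window on the positive side. -/
lemma card_centeredSum_near_mul_le_of_nonneg {n : ℕ} {u : Fin n → ℝ} {R : ℝ}
    (hR : ∀ i j, |u i - u j| ≤ R) {x a : ℝ} (hac : 0 < a + R * (n / 2)) :
    ((Finset.univ.filter fun π => |centeredSum u π - x| ≤ a).card : ℝ) *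
      ((x - a) / (2 * (a + R * (n / 2))) - 1) ≤ n.factorial := by
  have h := card_mul_le_of_reflection (W := outerSum u) (N := n) (c := R * (n / 2))
    (φ := fun k π => partialRev k * π) (x := x) (a := a) (fun π => by simp [outerSum])
    (outerSum_succ_sub_le hR) (fun k => mul_right_injective _) ?_ ?_ hac
  · simpa only [outerSum_self, Fintype.card_perm, Fintype.card_fin] using h
  · intro j k π hjk
    refine Finset.sum_congr rfl fun i _ => ?_
    simp only [Equiv.Perm.mul_apply, endDist_partialRev]
    split_ifs with h
    · rw [partialRev_apply, if_neg (by omega)]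
    · rfl
  · intro k π
    rw [outerSum_self, outerSum_self, eq_sub_iff_add_eq, centeredSum, centeredSum, outerSum,
      ← Finset.sum_add_distrib, Finset.mul_sum]
    refine Finset.sum_congr rfl fun i _ => ?_
    simp only [Equiv.Perm.mul_apply, partialRev_apply]
    split_ifs <;> first | omega | (try rw [centeredVal_rev]); ring

lemma centeredSum_neg {n : ℕ} (u : Fin n → ℝ) (π : Equiv.Perm (Fin n)) :
    centeredSum (-u) π = -centeredSum u π := by
  simp [centeredSum]

/-- The centred sum lies in a window of radius `a` around `x` with probability
`O((a + R n) / |x|)`, where `R` bounds the differences of the coefficients. -/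
lemma card_centeredSum_near_mul_le {n : ℕ} {u : Fin n → ℝ} {R : ℝ}
    (hR : ∀ i j, |u i - u j| ≤ R) {x a : ℝ} (hac : 0 < a + R * (n / 2)) :
    ((Finset.univ.filter fun π => |centeredSum u π - x| ≤ a).card : ℝ) *
      ((|x| - a) / (2 * (a + R * (n / 2))) - 1) ≤ n.factorial := by
  rcases le_total 0 x with hx | hx
  · rw [abs_of_nonneg hx]
    exact card_centeredSum_near_mul_le_of_nonneg hR hac
  · rw [abs_of_nonpos hx]
    have h := card_centeredSum_near_mul_le_of_nonneg (u := -u) (x := -x) (a := a)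
      (fun i j => by
        rw [show (-u) i - (-u) j = u j - u i by simp only [Pi.neg_apply]; ring]; exact hR j i) hac
    have hset : ∀ π, |centeredSum (-u) π - -x| = |centeredSum u π - x| := fun π => by
      rw [centeredSum_neg, ← abs_neg]
      ring_nf
    simpa only [hset] using h

/-! ### Re-inserting one element -/

lemma card_le_of_sub_le {m : ℕ} {S : Finset (Fin m)} {D : ℝ} (hD : 0 ≤ D)
    (h : ∀ b ∈ S, ∀ c ∈ S, ((c : ℕ) : ℝ) - ((b : ℕ) : ℝ) ≤ D) : (S.card : ℝ) ≤ 1 + D := by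
  rcases S.eq_empty_or_nonempty with rfl | hS
  · simp only [Finset.card_empty, Nat.cast_zero]
    linarith
  have hsub : S ⊆ Finset.Icc (S.min' hS) (S.max' hS) := fun b hb =>
    Finset.mem_Icc.2 ⟨S.min'_le b hb, S.le_max' b hb⟩
  have hle : ((S.min' hS : Fin m) : ℕ) ≤ (S.max' hS : Fin m) := S.min'_le _ (S.max'_mem hS)
  have hcard : S.card ≤ (S.max' hS : Fin m) + 1 - (S.min' hS : Fin m) :=
    (Finset.card_le_card hsub).trans (Fin.card_Icc _ _).le
  have hcard' : S.card + ((S.min' hS : Fin m) : ℕ) ≤ (S.max' hS : Fin m) + 1 := by omega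
  have hcast : (S.card : ℝ) + ((S.min' hS : Fin m) : ℕ) ≤ ((S.max' hS : Fin m) : ℕ) + 1 := by
    exact_mod_cast hcard'
  linarith [h _ (S.min'_mem hS) _ (S.max'_mem hS)]

/-- Double counting along chains. The maps `move · b` split `Ω` into chains of length `m`, a point
being determined by its chain and its `rank` in it. If each chain meets `X` at most `K` times and
`X'` contains every chain that meets `X`, then `m |X| ≤ K |X'|`. -/
lemma mul_card_le_of_chains {Ω : Type*} [Fintype Ω] [DecidableEq Ω] {m : ℕ} {rank : Ω → Fin m}
    {move : Ω → Fin m → Ω} (hrank : ∀ ω b, rank (move ω b) = b)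
    (hmove : ∀ ω b, move (move ω b) (rank ω) = ω) {X X' : Finset Ω} {K : ℝ}
    (hK : ∀ ω, ((Finset.univ.filter fun b => move ω b ∈ X).card : ℝ) ≤ K)
    (hX' : ∀ ω b, move ω b ∈ X → ω ∈ X') : (m : ℝ) * X.card ≤ K * X'.card := by
  -- `(ω, b) ↦ (move ω b, rank ω)` is an involution of `Ω × Fin m`.
  have hinj : Set.InjOn (fun p : Ω × Fin m => (⟨move p.1 p.2, rank p.1⟩ : Σ _ : Ω, Fin m))
      (X ×ˢ (Finset.univ : Finset (Fin m)) : Finset (Ω × Fin m)) := by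
    rintro ⟨ω, b⟩ _ ⟨ω', b'⟩ _ h
    simp only [Sigma.mk.injEq, heq_eq_eq] at h
    obtain ⟨h1, h2⟩ := h
    have hb : b = b' := by rw [← hrank ω b, h1, hrank]
    have hω : ω = ω' := by rw [← hmove ω b, h1, h2, hmove]
    rw [hb, hω]
  have hcard : X.card * m ≤ ∑ ω ∈ X', (Finset.univ.filter fun b => move ω b ∈ X).card := by
    rw [← Finset.card_sigma]
    calc X.card * m = (X ×ˢ (Finset.univ : Finset (Fin m))).card := by simp
      _ ≤ _ := Finset.card_le_card_of_injOn _ (fun p hp => ?_) hinj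
    have hp : p.1 ∈ X := by simpa using hp
    have hmem : move (move p.1 p.2) (rank p.1) ∈ X := by rwa [hmove]
    simpa using ⟨hX' _ _ hmem, hmem⟩
  calc (m : ℝ) * X.card = ((X.card * m : ℕ) : ℝ) := by push_cast; ring
    _ ≤ ∑ ω ∈ X', ((Finset.univ.filter fun b => move ω b ∈ X).card : ℝ) := by exact_mod_cast hcard
    _ ≤ ∑ _ω ∈ X', K := Finset.sum_le_sum fun ω _ => hK ω
    _ = K * X'.card := by rw [Finset.sum_const, nsmul_eq_mul, mul_comm]

section Insertion

variable {n m : ℕ} {A : Finset (Fin n)} (hA : A.card = m + 1)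

/-- The increasing enumeration of the values that `π` takes on `A`. -/
noncomputable def valueEmb (π : Equiv.Perm (Fin n)) : Fin (m + 1) ↪o Fin n :=
  (A.map π.toEmbedding).orderEmbOfFin (by rw [Finset.card_map, hA])

lemma mem_iff_exists_valueEmb (π : Equiv.Perm (Fin n)) (i : Fin n) :
    i ∈ A ↔ ∃ k, valueEmb hA π k = π i := by
  have h := Set.ext_iff.1 (Finset.range_orderEmbOfFin (A.map π.toEmbedding)
    (by rw [Finset.card_map, hA])) (π i)
  rw [← Set.mem_range, valueEmb, h]
  simp

lemma exists_valueEmb {i : Fin n} (hi : i ∈ A) (π : Equiv.Perm (Fin n)) :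
    ∃ k, valueEmb hA π k = π i := (mem_iff_exists_valueEmb hA π i).1 hi

variable {i₀ : Fin n} (hi₀ : i₀ ∈ A)

/-- The rank of `π i₀` among the values that `π` takes on `A`. -/
noncomputable def valueRank (π : Equiv.Perm (Fin n)) : Fin (m + 1) :=
  (exists_valueEmb hA hi₀ π).choose

lemma valueEmb_valueRank (π : Equiv.Perm (Fin n)) :
    valueEmb hA π (valueRank hA hi₀ π) = π i₀ := (exists_valueEmb hA hi₀ π).choose_spec

/-- The permutation obtained from `π` by giving `i₀` the rank `b` among the values on `A`; the
values taken on `A` and the relative order of those at the other elements of `A` stay the same. -/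
noncomputable def insertAt (π : Equiv.Perm (Fin n)) (b : Fin (m + 1)) : Equiv.Perm (Fin n) :=
  Equiv.Perm.viaEmbeddingHom (valueEmb hA π).toEmbedding
    (b.cycleRange⁻¹ * (valueRank hA hi₀ π).cycleRange) * π

lemma viaEmbeddingHom_valueEmb (π : Equiv.Perm (Fin n)) (e : Equiv.Perm (Fin (m + 1)))
    (k : Fin (m + 1)) :
    Equiv.Perm.viaEmbeddingHom (valueEmb hA π).toEmbedding e (valueEmb hA π k) =
      valueEmb hA π (e k) :=
  Equiv.Perm.viaEmbedding_apply e (valueEmb hA π).toEmbedding k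

lemma valueEmb_viaEmbeddingHom_mul (π : Equiv.Perm (Fin n)) (e : Equiv.Perm (Fin (m + 1))) :
    valueEmb hA (Equiv.Perm.viaEmbeddingHom (valueEmb hA π).toEmbedding e * π) =
      valueEmb hA π := by
  have hmap : A.map (Equiv.Perm.viaEmbeddingHom (valueEmb hA π).toEmbedding e * π).toEmbedding =
      A.map π.toEmbedding := by
    refine Finset.eq_of_subset_of_card_le (fun a ha => ?_) (by simp)
    obtain ⟨i, hi, rfl⟩ := Finset.mem_map.1 ha
    obtain ⟨k, hk⟩ := exists_valueEmb hA hi π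
    have : (Equiv.Perm.viaEmbeddingHom (valueEmb hA π).toEmbedding e * π) i =
        valueEmb hA π (e k) := by
      rw [Equiv.Perm.mul_apply, ← hk, viaEmbeddingHom_valueEmb]
    simp only [Equiv.coe_toEmbedding, this]
    exact Finset.orderEmbOfFin_mem _ _ _
  have aux : ∀ {B B' : Finset (Fin n)} (h : B.card = m + 1) (h' : B'.card = m + 1), B = B' →
      B.orderEmbOfFin h = B'.orderEmbOfFin h' := by
    rintro B _ h h' rfl
    rfl
  exact aux _ _ hmap

lemma valueEmb_insertAt (π : Equiv.Perm (Fin n)) (b : Fin (m + 1)) :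
    valueEmb hA (insertAt hA hi₀ π b) = valueEmb hA π :=
  valueEmb_viaEmbeddingHom_mul hA π _

lemma insertAt_apply_self (π : Equiv.Perm (Fin n)) (b : Fin (m + 1)) :
    insertAt hA hi₀ π b i₀ = valueEmb hA π b := by
  rw [insertAt, Equiv.Perm.mul_apply, ← valueEmb_valueRank hA hi₀ π, viaEmbeddingHom_valueEmb,
    Equiv.Perm.mul_apply, Fin.cycleRange_self, Equiv.Perm.inv_def, Fin.cycleRange_symm_zero]

lemma valueRank_insertAt (π : Equiv.Perm (Fin n)) (b : Fin (m + 1)) :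
    valueRank hA hi₀ (insertAt hA hi₀ π b) = b := by
  apply (valueEmb hA π).injective
  rw [← insertAt_apply_self hA hi₀ π b, ← valueEmb_valueRank hA hi₀ (insertAt hA hi₀ π b),
    valueEmb_insertAt]

lemma insertAt_insertAt (π : Equiv.Perm (Fin n)) (b : Fin (m + 1)) :
    insertAt hA hi₀ (insertAt hA hi₀ π b) (valueRank hA hi₀ π) = π := by
  rw [insertAt, valueRank_insertAt, valueEmb_insertAt, insertAt, ← mul_assoc, ← map_mul]
  simp [mul_assoc]

lemma insertAt_valueRank (π : Equiv.Perm (Fin n)) :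
    insertAt hA hi₀ π (valueRank hA hi₀ π) = π := by
  simp [insertAt]

lemma viaEmbeddingHom_swap {α β : Type*} [DecidableEq α] [DecidableEq β] (f : α ↪ β) (x y : α) :
    Equiv.Perm.viaEmbeddingHom f (Equiv.swap x y) = Equiv.swap (f x) (f y) := by
  ext a : 1
  rw [Equiv.Perm.viaEmbeddingHom_apply]
  by_cases ha : a ∈ Set.range f
  · obtain ⟨l, rfl⟩ := ha
    rw [Equiv.Perm.viaEmbedding_apply, f.injective.map_swap]
  · rw [Equiv.Perm.viaEmbedding_apply_of_notMem _ _ _ ha, Equiv.swap_apply_of_ne_of_ne]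
    · rintro rfl
      exact ha ⟨_, rfl⟩
    · rintro rfl
      exact ha ⟨_, rfl⟩

lemma cycleRange_succ_eq (k : Fin m) :
    k.succ.cycleRange = k.castSucc.cycleRange * Equiv.swap k.castSucc k.succ := by
  ext j : 1
  rw [Equiv.Perm.mul_apply]
  rcases lt_trichotomy j k.castSucc with h | rfl | h
  · rw [Equiv.swap_apply_of_ne_of_ne h.ne (h.trans k.castSucc_lt_succ).ne,
      Fin.cycleRange_of_lt h, Fin.cycleRange_of_lt (h.trans k.castSucc_lt_succ)]
  · rw [Equiv.swap_apply_left, Fin.cycleRange_of_lt k.castSucc_lt_succ,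
      Fin.cycleRange_of_gt k.castSucc_lt_succ, Fin.coeSucc_eq_succ]
  · rcases (Fin.castSucc_lt_iff_succ_le.1 h).eq_or_lt with rfl | h'
    · rw [Equiv.swap_apply_right, Fin.cycleRange_self, Fin.cycleRange_self]
    · rw [Equiv.swap_apply_of_ne_of_ne h.ne' h'.ne', Fin.cycleRange_of_gt h,
        Fin.cycleRange_of_gt h']

/-- Raising the rank of `i₀` by one exchanges the values at `i₀` and at one other element of `A`. -/
lemma insertAt_succ (π : Equiv.Perm (Fin n)) (k : Fin m) :
    ∃ j ∈ A, j ≠ i₀ ∧ insertAt hA hi₀ π k.castSucc j = valueEmb hA π k.succ ∧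
      insertAt hA hi₀ π k.succ = insertAt hA hi₀ π k.castSucc * Equiv.swap i₀ j := by
  set ρ := insertAt hA hi₀ π k.castSucc with hρ
  have hemb : valueEmb hA ρ = valueEmb hA π := valueEmb_insertAt hA hi₀ π _
  have hj : ρ (ρ.symm (valueEmb hA π k.succ)) = valueEmb hA π k.succ := ρ.apply_symm_apply _
  have hρ0 : ρ i₀ = valueEmb hA π k.castSucc := insertAt_apply_self hA hi₀ π _
  refine ⟨ρ.symm (valueEmb hA π k.succ), ?_, ?_, hj, ?_⟩
  · rw [mem_iff_exists_valueEmb hA ρ, hj, hemb]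
    exact ⟨_, rfl⟩
  · intro h
    rw [h, hρ0] at hj
    exact k.castSucc_lt_succ.ne ((valueEmb hA π).injective hj)
  · rw [Equiv.mul_swap_eq_swap_mul, hj, hρ0]
    have hvia := viaEmbeddingHom_swap (valueEmb hA π).toEmbedding k.castSucc k.succ
    simp only [RelEmbedding.coe_toEmbedding] at hvia
    rw [← hvia, hρ, insertAt, insertAt, ← mul_assoc, ← map_mul, cycleRange_succ_eq, mul_inv_rev,
      Equiv.swap_inv, mul_assoc]

lemma centeredSum_mul_swap_sub (u : Fin n → ℝ) (ρ : Equiv.Perm (Fin n)) {i j : Fin n}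
    (hij : j ≠ i) : centeredSum u (ρ * Equiv.swap i j) - centeredSum u ρ =
      (u i - u j) * (((ρ j : ℕ) : ℝ) - ((ρ i : ℕ) : ℝ)) := by
  rw [centeredSum, centeredSum, ← Finset.sum_sub_distrib,
    Fintype.sum_eq_add i j hij.symm fun l hl => ?_]
  · simp only [Equiv.Perm.mul_apply, Equiv.swap_apply_left, Equiv.swap_apply_right, centeredVal]
    ring
  · rw [Equiv.Perm.mul_apply, Equiv.swap_apply_of_ne_of_ne hl.1 hl.2, sub_self]

variable {u : Fin n → ℝ} {δ R : ℝ} (hδ : ∀ j ∈ A, j ≠ i₀ → δ ≤ u i₀ - u j)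
  (hR : ∀ j ∈ A, j ≠ i₀ → u i₀ - u j ≤ R)

include hδ in
lemma monotone_centeredSum_insertAt_sub (π : Equiv.Perm (Fin n)) :
    Monotone fun b => centeredSum u (insertAt hA hi₀ π b) -
      δ * ((valueEmb hA π b : ℕ) : ℝ) := by
  refine Fin.monotone_iff_le_succ.2 fun k => ?_
  obtain ⟨j, hjA, hj, hval, heq⟩ := insertAt_succ hA hi₀ π k
  have h := centeredSum_mul_swap_sub u (insertAt hA hi₀ π k.castSucc) hj
  rw [← heq, hval, insertAt_apply_self] at h
  have hlt : ((valueEmb hA π k.castSucc : ℕ) : ℝ) ≤ ((valueEmb hA π k.succ : ℕ) : ℝ) := by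
    exact_mod_cast (valueEmb hA π).monotone k.castSucc_lt_succ.le
  have := mul_le_mul_of_nonneg_right (hδ j hjA hj) (sub_nonneg.2 hlt)
  linarith

include hR in
lemma monotone_sub_centeredSum_insertAt (π : Equiv.Perm (Fin n)) :
    Monotone fun b => R * ((valueEmb hA π b : ℕ) : ℝ) -
      centeredSum u (insertAt hA hi₀ π b) := by
  refine Fin.monotone_iff_le_succ.2 fun k => ?_
  obtain ⟨j, hjA, hj, hval, heq⟩ := insertAt_succ hA hi₀ π k
  have h := centeredSum_mul_swap_sub u (insertAt hA hi₀ π k.castSucc) hj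
  rw [← heq, hval, insertAt_apply_self] at h
  have hlt : ((valueEmb hA π k.castSucc : ℕ) : ℝ) ≤ ((valueEmb hA π k.succ : ℕ) : ℝ) := by
    exact_mod_cast (valueEmb hA π).monotone k.castSucc_lt_succ.le
  have := mul_le_mul_of_nonneg_right (hR j hjA hj) (sub_nonneg.2 hlt)
  linarith

lemma monotone_valueEmb_sub (π : Equiv.Perm (Fin n)) :
    Monotone fun b => ((valueEmb hA π b : ℕ) : ℝ) - ((b : ℕ) : ℝ) := by
  refine Fin.monotone_iff_le_succ.2 fun k => ?_
  have h : (valueEmb hA π k.castSucc : ℕ) + 1 ≤ (valueEmb hA π k.succ : ℕ) :=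
    (valueEmb hA π).strictMono k.castSucc_lt_succ
  have h' : ((valueEmb hA π k.castSucc : ℕ) : ℝ) + 1 ≤ ((valueEmb hA π k.succ : ℕ) : ℝ) := by
    exact_mod_cast h
  simp only [Fin.val_castSucc, Fin.val_succ]
  push_cast
  linarith

include hA hi₀ hδ hR in
/-- If the coefficient at `i₀` exceeds the others in `A` by at least `δ` and at most `R`, then the
centred sum grows along each chain of re-insertions of `i₀` by at least `δ` per step and by at most
`R n` altogether. So a window of radius `l` holds at most `1 + 2 l / δ` points of a chain, and the
chains that meet it stay within the window of radius `l + R n`. -/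
lemma mul_card_centeredSum_near_le (hδ0 : 0 < δ) (hδR : δ ≤ R) {x l : ℝ} (hl : 0 ≤ l) :
    ((m : ℝ) + 1) * (Finset.univ.filter fun π => |centeredSum u π - x| ≤ l).card ≤
      (1 + 2 * l / δ) *
        (Finset.univ.filter fun π => |centeredSum u π - x| ≤ l + R * n).card := by
  have h := mul_card_le_of_chains (valueRank_insertAt hA hi₀) (insertAt_insertAt hA hi₀)
    (X := Finset.univ.filter fun π => |centeredSum u π - x| ≤ l)
    (X' := Finset.univ.filter fun π => |centeredSum u π - x| ≤ l + R * n) (K := 1 + 2 * l / δ)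
    ?_ ?_
  · exact_mod_cast h
  · intro π
    have hD : 0 ≤ 2 * l / δ := by positivity
    refine card_le_of_sub_le hD fun b hb c hc => ?_
    rcases le_total c b with hcb | hbc
    · have : ((c : ℕ) : ℝ) ≤ ((b : ℕ) : ℝ) := by exact_mod_cast hcb
      linarith
    have hb : |centeredSum u (insertAt hA hi₀ π b) - x| ≤ l := by simpa using hb
    have hc : |centeredSum u (insertAt hA hi₀ π c) - x| ≤ l := by simpa using hc
    have h1 := monotone_centeredSum_insertAt_sub hA hi₀ hδ π hbc
    have h2 := monotone_valueEmb_sub hA π hbc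
    simp only at h1 h2
    rw [le_div_iff₀ hδ0]
    have h3 : ((c : ℕ) : ℝ) - ((b : ℕ) : ℝ) ≤
        ((valueEmb hA π c : ℕ) : ℝ) - ((valueEmb hA π b : ℕ) : ℝ) := by linarith
    have h4 := mul_le_mul_of_nonneg_right h3 hδ0.le
    linarith [(abs_le.1 hb).1, (abs_le.1 hc).2]
  · intro π b hb
    have hb : |centeredSum u (insertAt hA hi₀ π b) - x| ≤ l := by simpa using hb
    have hR0 : 0 ≤ R := hδ0.le.trans hδR
    have hemb : ∀ c, 0 ≤ ((valueEmb hA π c : ℕ) : ℝ) ∧ ((valueEmb hA π c : ℕ) : ℝ) ≤ n := fun c =>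
      ⟨by positivity, by exact_mod_cast (valueEmb hA π c).isLt.le⟩
    have key : ∀ b c : Fin (m + 1), b ≤ c →
        0 ≤ centeredSum u (insertAt hA hi₀ π c) - centeredSum u (insertAt hA hi₀ π b) ∧
        centeredSum u (insertAt hA hi₀ π c) - centeredSum u (insertAt hA hi₀ π b) ≤ R * n := by
      intro b c hbc
      have h1 := monotone_centeredSum_insertAt_sub hA hi₀ hδ π hbc
      have h2 := monotone_sub_centeredSum_insertAt hA hi₀ hR π hbc
      have h3 : ((valueEmb hA π b : ℕ) : ℝ) ≤ ((valueEmb hA π c : ℕ) : ℝ) := by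
        exact_mod_cast (valueEmb hA π).monotone hbc
      simp only at h1 h2
      have h4 := mul_le_mul_of_nonneg_left h3 hδ0.le
      have h5 := mul_le_mul_of_nonneg_left (hemb c).2 hR0
      have h6 := mul_nonneg hR0 (hemb b).1
      constructor <;> linarith
    have hπ := insertAt_valueRank hA hi₀ π
    simp only [Finset.mem_filter, Finset.mem_univ, true_and]
    have hb' := abs_le.1 hb
    rw [abs_le]
    rcases le_total b (valueRank hA hi₀ π) with h | h <;>
    · have := key _ _ h
      rw [hπ] at this
      have hRn : 0 ≤ R * n := by positivity
      constructor <;> linarith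

end Insertion

/-! ### Two estimates combined -/

/-- The insertion estimate when the coefficient `u i₀` farthest from the mean lies above it. -/
lemma card_near_le_of_sub_mean_eq {n : ℕ} {u : Fin n → ℝ} {M : ℝ} (hM : 0 < M) {i₀ : Fin n}
    (hi₀ : u i₀ - (∑ i, u i) / n = M) (hu : ∀ i, |u i - (∑ i, u i) / n| ≤ M) {x l : ℝ}
    (hl : 0 ≤ l) :
    (n : ℝ) / 3 * (Finset.univ.filter fun π => |centeredSum u π - x| ≤ l).card ≤
      (1 + 4 * l / M) *
        (Finset.univ.filter fun π => |centeredSum u π - x| ≤ l + 2 * M * n).card := by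
  have hn : (n : ℝ) ≠ 0 := by
    have := i₀.isLt
    exact_mod_cast (by omega : n ≠ 0)
  set G : Finset (Fin n) := Finset.univ.filter fun j => M / 2 ≤ u i₀ - u j with hG
  -- The numbers `u i₀ - u j` have mean `M` and are at most `2 M`, so a third of them reach `M / 2`.
  have hGcard : (n : ℝ) / 3 ≤ G.card := by
    have h1 : ∑ j, (u i₀ - u j) = n * M := by
      rw [Finset.sum_sub_distrib, Finset.sum_const, Finset.card_univ, Fintype.card_fin,
        nsmul_eq_mul, ← hi₀]
      field_simp
    have h2 : ∑ j, (u i₀ - u j) ≤ ∑ j, (M / 2 + if j ∈ G then 3 / 2 * M else 0) := by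
      refine Finset.sum_le_sum fun j _ => ?_
      have := abs_le.1 (hu j)
      split_ifs with hj
      · linarith
      · have : ¬ M / 2 ≤ u i₀ - u j := by simpa [hG] using hj
        linarith
    rw [h1, Finset.sum_add_distrib, Finset.sum_const, Finset.card_univ, Fintype.card_fin,
      nsmul_eq_mul, Finset.sum_ite_mem, Finset.univ_inter, Finset.sum_const, nsmul_eq_mul] at h2
    have h3 : (n : ℝ) / 3 * M ≤ G.card * M := by linarith
    exact le_of_mul_le_mul_right h3 hM
  have hmem : i₀ ∈ insert i₀ G := Finset.mem_insert_self _ _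
  have hpos : 0 < (insert i₀ G).card := Finset.card_pos.2 ⟨_, hmem⟩
  have h := mul_card_centeredSum_near_le (m := (insert i₀ G).card - 1) (A := insert i₀ G)
    (by omega) hmem (u := u) (δ := M / 2) (R := 2 * M) ?_ ?_ (by linarith) (by linarith) (x := x) hl
  · have hcard : (n : ℝ) / 3 ≤ (((insert i₀ G).card - 1 : ℕ) : ℝ) + 1 := by
      have h1 : G.card ≤ (insert i₀ G).card - 1 + 1 := by
        have := Finset.card_le_card (Finset.subset_insert i₀ G)
        omega
      exact hGcard.trans (by exact_mod_cast h1)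
    rw [show 1 + 2 * l / (M / 2) = 1 + 4 * l / M by field_simp; ring] at h
    exact (mul_le_mul_of_nonneg_right hcard (by positivity)).trans h
  · intro j hj hne
    have hj := (Finset.mem_insert.1 hj).resolve_left hne
    exact (Finset.mem_filter.1 hj).2
  · intro j _ _
    linarith [(abs_le.1 (hu j)).1]

/-- The insertion estimate: if `M > 0` is the largest distance of a coefficient from the mean, then
a window of radius `l` has at most `O((1 + l / M) / n)` times the probability of the window of radius
`l + 2 M n`. -/
lemma card_near_le {n : ℕ} {u : Fin n → ℝ} {M : ℝ} (hM : 0 < M) {i₀ : Fin n}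
    (hi₀ : |u i₀ - (∑ i, u i) / n| = M) (hu : ∀ i, |u i - (∑ i, u i) / n| ≤ M) {x l : ℝ}
    (hl : 0 ≤ l) :
    (n : ℝ) / 3 * (Finset.univ.filter fun π => |centeredSum u π - x| ≤ l).card ≤
      (1 + 4 * l / M) *
        (Finset.univ.filter fun π => |centeredSum u π - x| ≤ l + 2 * M * n).card := by
  rcases abs_choice (u i₀ - (∑ i, u i) / n) with h | h
  · exact card_near_le_of_sub_mean_eq hM (h ▸ hi₀) hu hl
  · have hneg : ∀ i, (-u) i - (∑ i, (-u) i) / n = -(u i - (∑ i, u i) / n) := fun i => by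
      simp only [Pi.neg_apply, Finset.sum_neg_distrib]
      ring
    have key := card_near_le_of_sub_mean_eq (u := -u) (i₀ := i₀) hM
      (by rw [hneg, ← h, hi₀]) (fun i => by rw [hneg, abs_neg]; exact hu i) (x := -x) hl
    have hset : ∀ π, |centeredSum (-u) π - -x| = |centeredSum u π - x| := fun π => by
      rw [centeredSum_neg, ← abs_neg]
      ring_nf
    simpa only [hset] using key

/-- The bound in terms of counting permutations. With `r = |s| / M`, the cases `r ≥ n`, `r ≤ 128` and
`128 < r < n` use the reflection estimate, the insertion estimate and both, in this order. -/
lemma card_centered_event_le {n : ℕ} (hn : 2 ≤ n) {u : Fin n → ℝ} (hu : ∃ i, u i ≠ 0) :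
    (n : ℝ) * (Finset.univ.filter fun π =>
      |centeredSum u π - -((∑ i, u i) * ((n + 1) / 2))| ≤ |∑ i, u i|).card ≤
      2000 * n.factorial := by
  set s := ∑ i, u i with hs
  set x := -(s * (((n : ℝ) + 1) / 2)) with hx
  set X := Finset.univ.filter fun π => |centeredSum u π - x| ≤ |s| with hX
  have hXle : (X.card : ℝ) ≤ n.factorial := by
    have := Finset.card_le_univ X
    rw [Fintype.card_perm, Fintype.card_fin] at this
    exact_mod_cast this
  have hn' : (2 : ℝ) ≤ n := by exact_mod_cast hn
  have hfac : (0 : ℝ) < n.factorial := by exact_mod_cast n.factorial_pos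
  have hxabs : |x| = |s| * ((n + 1) / 2) := by
    rw [hx, abs_neg, abs_mul, abs_of_pos (by positivity : (0 : ℝ) < (n + 1) / 2)]
  have : Nonempty (Fin n) := ⟨⟨0, by omega⟩⟩
  obtain ⟨i₀, hi₀⟩ := Finite.exists_max fun i => |u i - s / n|
  set M := |u i₀ - s / n| with hM
  have hM0 : 0 ≤ M := abs_nonneg _
  have hR : ∀ i j, |u i - u j| ≤ 2 * M := fun i j => by
    have h1 := abs_le.1 (hi₀ i)
    have h2 := abs_le.1 (hi₀ j)
    rw [abs_le]
    constructor <;> linarith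
  rcases le_or_gt (n : ℝ) 18 with hsmall | hlarge
  -- The constant makes the bound trivial for small `n`.
  · nlinarith
  rcases le_or_gt (n * M) |s| with hbig | hmid
  · -- The sum of the coefficients dominates: reflection applies to the window itself.
    have hs0 : 0 < |s| := by
      rcases hM0.eq_or_lt with h0 | hpos
      · rw [abs_pos]
        intro h
        obtain ⟨i, hi⟩ := hu
        have := hi₀ i
        rw [← h0, h, zero_div, sub_zero] at this
        exact hi (abs_nonpos_iff.1 this)
      · exact lt_of_lt_of_le (by positivity) hbig
    have hpos : 0 < |s| + 2 * M * (n / 2) := by positivity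
    have h := card_centeredSum_near_mul_le hR (x := x) (a := |s|) hpos
    have hq : (n : ℝ) / 16 ≤ (|x| - |s|) / (2 * (|s| + 2 * M * (n / 2))) - 1 := by
      rw [le_sub_iff_add_le, le_div_iff₀ (by positivity), hxabs]
      have h1 : 2 * (|s| + 2 * M * (n / 2)) ≤ 4 * |s| := by linarith
      have h2 := mul_le_mul_of_nonneg_left h1 (by positivity : (0 : ℝ) ≤ n / 16 + 1)
      have h3 : ((n : ℝ) / 16 + 1) * 4 ≤ (n + 1) / 2 - 1 := by linarith
      have h4 := mul_le_mul_of_nonneg_right h3 hs0.le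
      linarith
    have h1 := mul_le_mul_of_nonneg_left hq (Nat.cast_nonneg X.card)
    have h2 : (X.card : ℝ) * (n / 16) ≤ n.factorial := h1.trans h
    linarith
  have hMpos : 0 < M := by
    rcases hM0.eq_or_lt with h0 | hpos
    · rw [← h0, mul_zero] at hmid
      exact absurd (abs_nonneg s) (not_le.2 hmid)
    · exact hpos
  have hins := card_near_le hMpos hM.symm hi₀ (x := x) (abs_nonneg s)
  set X' := Finset.univ.filter fun π => |centeredSum u π - x| ≤ |s| + 2 * M * n with hX'
  have hX'le : (X'.card : ℝ) ≤ n.factorial := by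
    have := Finset.card_le_univ X'
    rw [Fintype.card_perm, Fintype.card_fin] at this
    exact_mod_cast this
  set r := |s| / M with hr
  have hsr : |s| = r * M := (div_mul_cancel₀ |s| hMpos.ne').symm
  have hr0 : 0 ≤ r := by positivity
  rw [mul_div_assoc, ← hr] at hins
  rcases le_or_gt r 128 with hrs | hrl
  · have h1 : (1 + 4 * r) * X'.card ≤ (1 + 4 * 128) * n.factorial :=
      mul_le_mul (by linarith) hX'le (Nat.cast_nonneg _) (by norm_num)
    linarith
  · -- The enlarged window has radius `O(M n)` and lies at distance `|s| (n + 1) / 2` from the mean.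
    have hrn : r < n := by
      rw [hsr] at hmid
      exact lt_of_mul_lt_mul_right hmid hM0
    have h := card_centeredSum_near_mul_le hR (x := x) (a := |s| + 2 * M * n) (by positivity)
    have hq : r / 32 ≤ (|x| - (|s| + 2 * M * n)) /
        (2 * (|s| + 2 * M * n + 2 * M * (n / 2))) - 1 := by
      rw [le_sub_iff_add_le, le_div_iff₀ (by positivity), hxabs, hsr]
      have h1 : 2 * (r * M + 2 * M * n + 2 * M * (n / 2)) ≤ 8 * n * M := by nlinarith
      have h2 := mul_le_mul_of_nonneg_left h1 (by positivity : (0 : ℝ) ≤ r / 32 + 1)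
      refine h2.trans ?_
      have h3 : 128 * (n : ℝ) ≤ r * n := by gcongr
      have h4 : (r / 32 + 1) * (8 * n) ≤ r * ((n + 1) / 2) - (r + 2 * n) := by nlinarith
      have h5 := mul_le_mul_of_nonneg_right h4 hM0
      linarith
    have h1 := mul_le_mul_of_nonneg_left hq (Nat.cast_nonneg X'.card)
    have h2 : (X'.card : ℝ) * (r / 32) ≤ n.factorial := h1.trans h
    have h3 : (1 + 4 * r) * X'.card ≤ 5 * r * X'.card :=
      mul_le_mul_of_nonneg_right (by linarith) (Nat.cast_nonneg _)
    linarith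

theorem mainTheorem5 :
    ∃ C : ℝ, 0 < C ∧
      ∀ (n : ℕ), 2 ≤ n → ∀ (u : Fin n → ℝ), (∃ i, u i ≠ 0) →
        ∀ (Ω : Type*) [MeasurableSpace Ω] (P : Measure Ω) [IsProbabilityMeasure P]
          (π : Ω → Equiv.Perm (Fin n)), HasLaw π (uniformPermutation n) P →
          P.real {ω | |∑ i, u i * permValue (π ω) i| ≤ |∑ i, u i|} ≤ C / n := by
  refine ⟨2000, by norm_num, fun n hn u hu Ω _ P _ π hπ => ?_⟩
  have hsum : ∀ σ : Equiv.Perm (Fin n), ∑ i, u i * permValue σ i =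
      centeredSum u σ - -((∑ i, u i) * (((n : ℝ) + 1) / 2)) := by
    intro σ
    rw [centeredSum, sub_neg_eq_add, Finset.sum_mul, ← Finset.sum_add_distrib]
    refine Finset.sum_congr rfl fun i _ => ?_
    simp only [permValue, centeredVal]
    ring
  have hlaw : P.real {ω | |∑ i, u i * permValue (π ω) i| ≤ |∑ i, u i|} =
      (uniformPermutation n).real
        {σ | |∑ i, u i * permValue σ i| ≤ |∑ i, u i|} :=
    hπ.measureReal_eq (p := fun σ => |∑ i, u i * permValue σ i| ≤ |∑ i, u i|) trivial
  classical
  rw [hlaw, measureReal_def, uniformPermutation,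
    PMF.toMeasure_uniformOfFintype_apply _ (by trivial), ENNReal.toReal_div,
    ENNReal.toReal_natCast, ENNReal.toReal_natCast, Fintype.card_perm, Fintype.card_fin]
  have h := card_centered_event_le hn hu
  have hn0 : (0 : ℝ) < n := by positivity
  have hfac : (0 : ℝ) < n.factorial := by exact_mod_cast n.factorial_pos
  have hcard : Fintype.card {σ : Equiv.Perm (Fin n) | |∑ i, u i * permValue σ i| ≤ |∑ i, u i|} =
      (Finset.univ.filter fun σ => |centeredSum u σ - -((∑ i, u i) * (((n : ℝ) + 1) / 2))| ≤
        |∑ i, u i|).card := by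
    simp only [hsum]
    exact Fintype.card_subtype _
  rw [hcard, div_le_div_iff₀ hfac hn0]
  linarith
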